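/- Let $\mathbb{S}^2$ be the unit sphere in $\mathbb{R}^3$ with its surface measure $dp$ (the two-dimensional Hausdorff measure, of total mass $4\pi$), and let $$\mathcal{P}(\mathbb{S}^2)=\Big\{f\in L^1(\mathbb{S}^2): f\ge 0 \text{ a.e.},\ \int_{\mathbb{S}^2} f\,dp=1\Big\}.$$ For $\eta\in\mathbb{R}$ define $\mathcal{F}:\mathcal{P}(\mathbb{S}^2)\to\mathbb{R}\cup\{+\infty\}$ by $$\mathcal{F}(f)=\int_{\mathbb{S}^2} f(p)\ln f(p)-f(p)\ln\Big(\int_{\mathbb{S}^2}\big((p\cdot q)^2-\tfrac13\big)f(q)\,dq-\eta\Big)\,dp,$$ where $-\ln$ is extended by $+\infty$ to non-positive arguments, and $0\cdot(+\infty)=0$, $0\ln 0=0$. Let $\mathrm{dom}(\mathcal{F})=\{f\in\mathcal{P}(\mathbb{S}^2):\mathcal{F}(f)<+\infty\}$, let $$\mathcal{P}_+(\mathbb{S}^2)=\Big\{f\in\mathcal{P}(\mathbb{S}^2):\exists M>0,\ \tfrac1M\le f(p)\le M \text{ for a.e. } p\Big\},$$ and let $f_U=\frac{1}{4\pi}$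 be the isotropic state. Then the following hold. 1. If $\eta<0$, then $f_U$ is a global minimiser of $\mathcal{F}$ on $\mathcal{P}_+(\mathbb{S}^2)\cap\mathrm{dom}(\mathcal{F})$; if moreover $\eta\neq-\frac{2}{15}$, then it is the unique global minimiser of $\mathcal{F}$ on this set. 2. If $\eta<-\frac13$, then $f_U$ is the unique global minimiser of $\mathcal{F}$ on $\mathcal{P}(\mathbb{S}^2)$. -/

import Mathlib

open MeasureTheory

noncomputable section

namespace DenseNematic

/-- Euclidean three-space. -/
abbrev E3 : Type := EuclideanSpace ℝ (Fin 3)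

/-- The unit sphere in Euclidean three-space. -/
abbrev S2 : Type := Metric.sphere (0 : E3) 1

/-- The surface measure on the unit sphere (of total mass `4 * π`). -/
def surf : Measure S2 := (volume : Measure E3).toSphere

instance : IsFiniteMeasure surf := by
  unfold surf
  infer_instance

/-- The Lebesgue integral of an extended-real-valued function: the integral of the positive part
minus the integral of the negative part. -/
def erealIntegral {α : Type*} [MeasurableSpace α] (μ : Measure α) (g : α → EReal) : EReal :=
  ((∫⁻ x, (g x).toENNReal ∂μ : ENNReal) : EReal) -
    ((∫⁻ x, (-g x).toENNReal ∂μ : ENNReal) : EReal)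

/-- The function `-ln`, extended by `+∞` to non-positive arguments. -/
def negLog (x : ℝ) : EReal :=
  if 0 < x then ((-Real.log x : ℝ) : EReal) else ⊤

/-- The probability densities on the sphere: the elements `f` of `L¹` with `f ≥ 0` almost
everywhere and total integral one. -/
def densities : Set (Lp ℝ 1 surf) :=
  {f | (∀ᵐ p ∂surf, 0 ≤ f p) ∧ ∫ p, f p ∂surf = 1}

/-- The free volume term `∫ ((p · q)² - 1/3) f(q) dq - η` at the orientation `p`. -/
def freeVolume (η : ℝ) (f : Lp ℝ 1 surf) (p : S2) : ℝ :=
  (∫ q, ((inner ℝ (p : E3) (q : E3)) ^ 2 - 1 / 3) * f q ∂surf) - η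

/-- The free energy `∫ f ln f - f ln (∫ ((p · q)² - 1/3) f(q) dq - η) dp`. The conventions of
`EReal` and `Real.log` give `0 * (+∞) = 0` and `0 * ln 0 = 0`. -/
def freeEnergy (η : ℝ) (f : Lp ℝ 1 surf) : EReal :=
  erealIntegral surf fun p =>
    ((f p * Real.log (f p) : ℝ) : EReal) + (f p : EReal) * negLog (freeVolume η f p)

/-- The effective domain of the free energy: the densities of finite energy. -/
def energyDomain (η : ℝ) : Set (Lp ℝ 1 surf) :=
  {f | f ∈ densities ∧ freeEnergy η f < ⊤}

/-- The densities that are bounded away from zero and infinity. -/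
def boundedDensities : Set (Lp ℝ 1 surf) :=
  {f | f ∈ densities ∧ ∃ M : ℝ, 0 < M ∧ ∀ᵐ p ∂surf, 1 / M ≤ f p ∧ f p ≤ M}

/-- The isotropic state, the constant density `1 / (4 * π)`. -/
def isotropic : Lp ℝ 1 surf :=
  Lp.const 1 surf (1 / (4 * Real.pi))

/-- `f` is a global minimiser of `F` on the set `S`. -/
def IsGlobalMinimiserOn {X : Type*} (F : X → EReal) (S : Set X) (f : X) : Prop :=
  f ∈ S ∧ ∀ g ∈ S, F f ≤ F g

/-- `f` is the unique global minimiser of `F` on the set `S`. -/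
def IsUniqueGlobalMinimiserOn {X : Type*} (F : X → EReal) (S : Set X) (f : X) : Prop :=
  IsGlobalMinimiserOn F S f ∧ ∀ g, IsGlobalMinimiserOn F S g → g = f

end DenseNematic

end

/-!
The free energy is a relative entropy. Write `V` for the free volume of a density `f`. The kernel
`(p · q)² - 1/3` integrates to zero in either variable, so `V` has total mass `c = -4πη`, which does
not depend on `f`. Where `V` is positive almost everywhere, `V / c` is therefore a probability
density and
`F(f) = ∫ f ln (f / (V / c)) dp - ln c ≥ -ln c = F(f_U)`
by the Gibbs inequality (`freeEnergy_eq`, `neg_log_le_freeEnergy`, `freeEnergy_isotropic`).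

Positivity of `V` is automatic for `η < -1/3`, since the kernel is at least `-1/3`
(`le_freeVolume`); for a density bounded away from zero it follows from finiteness of the energy
(`freeVolume_pos_of_mem`).

Equality in the Gibbs inequality forces `f = V / c` (`ae_eq_freeVolume_of_freeEnergy_eq`). As an
integral operator the kernel is `8π/15` times a projection (`integral_kernel_mul_kernel`), so
`u = V + η`, the image of `f` under this operator, satisfies `u = (8π/15) / (-4πη) u`. Hence `u = 0`
and `f` is constant unless `η = -2/15` (`eq_isotropic_of_ae_eq_freeVolume`).

The second and fourth moments of the surface measure behind these identities come from its
invariance under rotations: `∫ (p · x)ⁿ dp` is a multiple of `‖x‖ⁿ`, polarisation in `x` gives the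
mixed moments, and summation over an orthonormal basis fixes the constants.
-/

namespace DenseNematic

open MeasureTheory Set
open scoped Pointwise

/-! ### Moments of the surface measure -/

/-- A linear isometry of the space restricts to the sphere, and the restriction preserves the
surface measure. -/
theorem measurePreserving_sphere (e : E3 ≃ₗᵢ[ℝ] E3) :
    MeasurePreserving
      (e.toHomeomorph.subtype (p := (· ∈ Metric.sphere (0 : E3) 1))
        (q := (· ∈ Metric.sphere (0 : E3) 1)) (by simp)) surf surf := by
  refine ⟨(Homeomorph.continuous _).measurable, ?_⟩
  ext s hs
  rw [Measure.map_apply (Homeomorph.continuous _).measurable hs, surf,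
    Measure.toSphere_apply' _ hs,
    Measure.toSphere_apply' _ ((Homeomorph.continuous _).measurable hs)]
  congr 1
  rw [← e.measurePreserving.measure_preimage_emb e.toHomeomorph.measurableEmbedding
    (Ioo (0 : ℝ) 1 • (Subtype.val '' s))]
  congr 1
  ext x
  constructor
  · rintro ⟨r, hr, y, ⟨p, hp, rfl⟩, rfl⟩
    exact ⟨r, hr, _, ⟨_, hp, rfl⟩, by simp [Homeomorph.subtype]⟩
  · rintro ⟨r, hr, y, ⟨p, hp, rfl⟩, h⟩
    refine ⟨r, hr, e.symm p, ⟨⟨e.symm p, by simp⟩, ?_, rfl⟩, ?_⟩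
    · simpa [Homeomorph.subtype] using hp
    · apply e.injective
      simpa using h

theorem integral_sphere_comp_isometry (e : E3 ≃ₗᵢ[ℝ] E3) (g : E3 → ℝ) :
    ∫ p : S2, g (e p) ∂surf = ∫ p : S2, g p ∂surf :=
  (measurePreserving_sphere e).integral_comp (Homeomorph.measurableEmbedding _) (fun p => g p)

/-- Rotational invariance of the surface measure: reflections act transitively on vectors of a
given length, so the moments of `p ↦ p · x` depend only on the length of `x`. -/
theorem integral_inner_pow_eq_of_norm_eq {x y : E3} (h : ‖x‖ = ‖y‖) (n : ℕ) :
    ∫ p : S2, inner ℝ (p : E3) x ^ n ∂surf = ∫ p : S2, inner ℝ (p : E3) y ^ n ∂surf := by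
  rw [← integral_sphere_comp_isometry (Submodule.reflection (Submodule.span ℝ {x - y})ᗮ)
    (fun p => inner ℝ p y ^ n)]
  congr! 3 with p
  rw [← LinearIsometryEquiv.inner_map_map (Submodule.reflection (Submodule.span ℝ {x - y})ᗮ) _ x,
    Submodule.reflection_sub h]

theorem integral_inner_pow (x : E3) (n : ℕ) {q : E3} (hq : ‖q‖ = 1) :
    ∫ p : S2, inner ℝ (p : E3) x ^ n ∂surf =
      ‖x‖ ^ n * ∫ p : S2, inner ℝ (p : E3) q ^ n ∂surf := by
  have h : ‖x‖ = ‖‖x‖ • q‖ := by simp [norm_smul, hq]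
  rw [integral_inner_pow_eq_of_norm_eq h, ← integral_const_mul]
  simp only [inner_smul_right, mul_pow]

theorem surf_real_univ : surf.real univ = 4 * Real.pi := by
  rw [surf, Measure.toSphere_real_apply_univ, measureReal_def,
    EuclideanSpace.volume_ball_fin_three, ENNReal.toReal_mul, ENNReal.toReal_ofReal (by positivity)]
  simp
  ring

theorem integrable_of_continuous {g : S2 → ℝ} (hg : Continuous g) : Integrable g surf :=
  hg.integrable_of_hasCompactSupport (HasCompactSupport.of_compactSpace g)

theorem sum_inner_basis_sq (x : E3) :
    ∑ i, inner ℝ x (EuclideanSpace.basisFun (Fin 3) ℝ i) ^ 2 = ‖x‖ ^ 2 :=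
  (EuclideanSpace.basisFun (Fin 3) ℝ).sum_sq_inner_left x

theorem integral_inner_sq (q : S2) :
    ∫ p : S2, inner ℝ (p : E3) (q : E3) ^ 2 ∂surf = 4 * Real.pi / 3 := by
  have h : ∑ i, ∫ p : S2, inner ℝ (p : E3) (EuclideanSpace.basisFun (Fin 3) ℝ i) ^ 2 ∂surf =
      4 * Real.pi := by
    rw [← integral_finsetSum _ fun i _ => integrable_of_continuous (by fun_prop)]
    simp_rw [sum_inner_basis_sq, norm_eq_of_mem_sphere]
    simp [surf_real_univ]
  rw [Fin.sum_univ_three] at h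
  have hb : ∀ i, ∫ p : S2, inner ℝ (p : E3) (EuclideanSpace.basisFun (Fin 3) ℝ i) ^ 2 ∂surf =
      ∫ p : S2, inner ℝ (p : E3) (q : E3) ^ 2 ∂surf := fun i =>
    integral_inner_pow_eq_of_norm_eq
      (((EuclideanSpace.basisFun (Fin 3) ℝ).norm_eq_one i).trans (norm_eq_of_mem_sphere q).symm) 2
  rw [hb, hb, hb] at h
  linarith

/-- The mixed fourth moments, by polarisation of `x ↦ ∫ (p · x)⁴ dp = a |x|⁴`. -/
theorem integral_inner_sq_mul_inner_sq_of_fourth_moment (q r s : S2) :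
    ∫ p : S2, inner ℝ (p : E3) (q : E3) ^ 2 * inner ℝ (p : E3) (r : E3) ^ 2 ∂surf =
      (∫ p : S2, inner ℝ (p : E3) (s : E3) ^ 4 ∂surf) *
        (1 + 2 * inner ℝ (q : E3) (r : E3) ^ 2) / 3 := by
  have e : ∀ p : S2, inner ℝ (p : E3) (q : E3) ^ 2 * inner ℝ (p : E3) (r : E3) ^ 2 =
      (1 / 12) * (inner ℝ (p : E3) (q + r : E3) ^ 4 + inner ℝ (p : E3) (q - r : E3) ^ 4
        - 2 * inner ℝ (p : E3) (q : E3) ^ 4 - 2 * inner ℝ (p : E3) (r : E3) ^ 4) := by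
    intro p
    rw [inner_add_right, inner_sub_right]
    ring
  have hi : ∀ x : E3, Integrable (fun p : S2 => inner ℝ (p : E3) x ^ 4) surf := fun x =>
    integrable_of_continuous (by fun_prop)
  simp_rw [e]
  rw [integral_const_mul, integral_sub, integral_sub, integral_add (hi _) (hi _),
    integral_const_mul, integral_const_mul]
  · have h1 : ‖(q + r : E3)‖ ^ 4 = (2 + 2 * inner ℝ (q : E3) (r : E3)) ^ 2 := by
      rw [show 4 = 2 * 2 from rfl, pow_mul, @norm_add_sq_real]
      simp only [norm_eq_of_mem_sphere]; ring
    have h2 : ‖(q - r : E3)‖ ^ 4 = (2 - 2 * inner ℝ (q : E3) (r : E3)) ^ 2 := by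
      rw [show 4 = 2 * 2 from rfl, pow_mul, @norm_sub_sq_real]
      simp only [norm_eq_of_mem_sphere]; ring
    rw [integral_inner_pow (q + r : E3) 4 (norm_eq_of_mem_sphere s),
      integral_inner_pow (q - r : E3) 4 (norm_eq_of_mem_sphere s),
      integral_inner_pow (q : E3) 4 (norm_eq_of_mem_sphere s),
      integral_inner_pow (r : E3) 4 (norm_eq_of_mem_sphere s), h1, h2]
    simp only [norm_eq_of_mem_sphere]
    ring
  · exact (hi _).add (hi _)
  · exact (hi _).const_mul _
  · exact ((hi _).add (hi _)).sub ((hi _).const_mul _)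
  · exact (hi _).const_mul _

theorem integral_inner_sq_mul_inner_sq (q r : S2) :
    ∫ p : S2, inner ℝ (p : E3) (q : E3) ^ 2 * inner ℝ (p : E3) (r : E3) ^ 2 ∂surf =
      4 * Real.pi / 15 * (1 + 2 * inner ℝ (q : E3) (r : E3) ^ 2) := by
  -- Summing over an orthonormal basis in place of `r` determines the fourth moment.
  let b : Fin 3 → S2 := fun i =>
    ⟨EuclideanSpace.basisFun (Fin 3) ℝ i, by simp⟩
  have hb : ∀ p : S2, ∑ i, inner ℝ (p : E3) (b i : E3) ^ 2 = 1 := fun p => by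
    simpa only [norm_eq_of_mem_sphere, one_pow] using sum_inner_basis_sq p
  have h : ∑ i, ∫ p : S2, inner ℝ (p : E3) (q : E3) ^ 2 * inner ℝ (p : E3) (b i : E3) ^ 2 ∂surf =
      4 * Real.pi / 3 := by
    rw [← integral_finsetSum _ fun i _ => integrable_of_continuous (by fun_prop)]
    simp_rw [← Finset.mul_sum, hb, mul_one]
    exact integral_inner_sq q
  simp_rw [integral_inner_sq_mul_inner_sq_of_fourth_moment q _ q] at h ⊢
  rw [← Finset.sum_div, ← Finset.mul_sum, Finset.sum_add_distrib, ← Finset.mul_sum, hb] at h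
  simp at h
  linear_combination (1 + 2 * inner ℝ (q : E3) (r : E3) ^ 2) * h / 15

/-- The interaction kernel `(p · q)² - 1/3`. -/
noncomputable def kernel (p q : S2) : ℝ := inner ℝ (p : E3) (q : E3) ^ 2 - 1 / 3

theorem continuous_kernel : Continuous fun z : S2 × S2 => kernel z.1 z.2 := by
  unfold kernel; fun_prop

theorem continuous_kernel_right (p : S2) : Continuous fun q => kernel p q := by
  unfold kernel; fun_prop

theorem kernel_comm (p q : S2) : kernel p q = kernel q p := by
  rw [kernel, kernel, real_inner_comm]

theorem kernel_ge (p q : S2) : -1 / 3 ≤ kernel p q := by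
  rw [kernel]
  nlinarith [sq_nonneg (inner ℝ (p : E3) (q : E3))]

theorem kernel_le (p q : S2) : kernel p q ≤ 1 := by
  have h := abs_real_inner_le_norm (p : E3) (q : E3)
  rw [norm_eq_of_mem_sphere, norm_eq_of_mem_sphere, mul_one, ← sq_le_one_iff_abs_le_one] at h
  rw [kernel]
  linarith

theorem integral_kernel (p : S2) : ∫ q, kernel p q ∂surf = 0 := by
  simp_rw [kernel_comm p]
  simp only [kernel]
  rw [integral_sub (integrable_of_continuous (by fun_prop)) (integrable_const _),
    integral_inner_sq, integral_const, surf_real_univ, smul_eq_mul]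
  ring

/-- The kernel is, up to the factor `8π/15`, idempotent for composition: as an integral operator it
is a multiple of the projection onto the spherical harmonics of degree two. -/
theorem integral_kernel_mul_kernel (p r : S2) :
    ∫ q, kernel p q * kernel q r ∂surf = 8 * Real.pi / 15 * kernel p r := by
  have e : ∀ q, kernel p q * kernel q r =
      inner ℝ (q : E3) (p : E3) ^ 2 * inner ℝ (q : E3) (r : E3) ^ 2
        - (1 / 3) * inner ℝ (q : E3) (p : E3) ^ 2 - (1 / 3) * kernel r q := fun q => by
    rw [kernel_comm p, kernel_comm r]
    simp only [kernel]
    ring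
  simp_rw [e]
  rw [integral_sub, integral_sub, integral_const_mul, integral_const_mul, integral_kernel,
    integral_inner_sq, integral_inner_sq_mul_inner_sq, kernel]
  · ring
  · exact integrable_of_continuous (by fun_prop)
  · exact integrable_of_continuous (by fun_prop)
  · exact integrable_of_continuous (by fun_prop)
  · exact (integrable_of_continuous (continuous_kernel_right r)).const_mul _

/-! ### The Gibbs inequality -/

/-- The defect `a ln (a / b) - a + b` of the Gibbs inequality, for `a ≥ 0` and `b > 0`. -/
noncomputable def gibbsDefect (a b : ℝ) : ℝ := a * Real.log a - a * Real.log b - a + b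

theorem gibbsDefect_nonneg {a b : ℝ} (ha : 0 ≤ a) (hb : 0 < b) : 0 ≤ gibbsDefect a b := by
  rcases ha.eq_or_lt with rfl | ha
  · simp [gibbsDefect, hb.le]
  · have h := Real.log_le_sub_one_of_pos (div_pos hb ha)
    rw [Real.log_div hb.ne' ha.ne'] at h
    have h2 := mul_le_mul_of_nonneg_left h ha.le
    have h3 : a * (b / a - 1) = b - a := by field_simp
    rw [gibbsDefect]
    linarith

theorem gibbsDefect_self (a : ℝ) : gibbsDefect a a = 0 := by
  rw [gibbsDefect]; ring

theorem eq_of_gibbsDefect_eq_zero {a b : ℝ} (ha : 0 ≤ a) (hb : 0 < b) (h : gibbsDefect a b = 0) :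
    a = b := by
  rcases ha.eq_or_lt with rfl | ha
  · simpa [gibbsDefect, eq_comm] using h
  · by_contra hab
    have h1 := Real.log_lt_sub_one_of_pos (div_pos hb ha)
      (by rw [Ne, div_eq_one_iff_eq ha.ne']; exact Ne.symm hab)
    rw [Real.log_div hb.ne' ha.ne'] at h1
    have h2 := mul_lt_mul_of_pos_left h1 ha
    have h3 : a * (b / a - 1) = b - a := by field_simp
    rw [gibbsDefect] at h
    linarith

/-- For a sum of a nonnegative function, possibly of infinite integral, and an integrable one, the
extended integral is additive. -/
theorem erealIntegral_eq_lintegral_add {α : Type*} [MeasurableSpace α] {μ : Measure α}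
    {g : α → EReal} {h k : α → ℝ} (hm : AEMeasurable h μ) (h0 : ∀ᵐ x ∂μ, 0 ≤ h x)
    (hk : Integrable k μ) (hg : ∀ᵐ x ∂μ, g x = ((h x + k x : ℝ) : EReal)) :
    erealIntegral μ g =
      ((∫⁻ x, ENNReal.ofReal (h x) ∂μ : ENNReal) : EReal) + ((∫ x, k x ∂μ : ℝ) : EReal) := by
  have hpos : ∫⁻ x, (g x).toENNReal ∂μ = ∫⁻ x, ENNReal.ofReal (h x + k x) ∂μ :=
    lintegral_congr_ae (by filter_upwards [hg] with x hx; rw [hx, EReal.real_coe_toENNReal])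
  have hneg : ∫⁻ x, (-g x).toENNReal ∂μ = ∫⁻ x, ENNReal.ofReal (-(h x + k x)) ∂μ :=
    lintegral_congr_ae (by
      filter_upwards [hg] with x hx
      rw [hx, ← EReal.coe_neg, EReal.real_coe_toENNReal])
  rw [erealIntegral, hpos, hneg]
  by_cases htop : ∫⁻ x, ENNReal.ofReal (h x) ∂μ = ⊤
  · have hkneg : ∫⁻ x, ENNReal.ofReal (-k x) ∂μ < ⊤ := hk.neg.lintegral_lt_top
    have hn : ∫⁻ x, ENNReal.ofReal (-(h x + k x)) ∂μ ≠ ⊤ := by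
      refine ((lintegral_mono_ae ?_).trans_lt hkneg).ne
      filter_upwards [h0] with x hx
      exact ENNReal.ofReal_le_ofReal (by linarith)
    have hp : ∫⁻ x, ENNReal.ofReal (h x + k x) ∂μ = ⊤ := by
      by_contra hne
      have hle : ∫⁻ x, ENNReal.ofReal (h x) ∂μ ≤
          ∫⁻ x, ENNReal.ofReal (h x + k x) ∂μ + ∫⁻ x, ENNReal.ofReal (-k x) ∂μ := by
        rw [← lintegral_add_right' (g := fun x => ENNReal.ofReal (-k x)) _
          hk.aestronglyMeasurable.aemeasurable.neg.ennreal_ofReal]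
        refine lintegral_mono fun x => ?_
        refine le_trans (le_of_eq ?_) ENNReal.ofReal_add_le
        congr 1; ring
      rw [htop, top_le_iff, ENNReal.add_eq_top] at hle
      exact hle.elim hne hkneg.ne
    rw [hp, htop, EReal.coe_ennreal_top, EReal.top_add_coe]
    lift ∫⁻ x, ENNReal.ofReal (-(h x + k x)) ∂μ to NNReal using hn with c
    exact EReal.top_sub_coe _
  · have hh : Integrable h μ := by
      refine ⟨hm.aestronglyMeasurable, ?_⟩
      rw [hasFiniteIntegral_iff_ofReal h0]
      exact Ne.lt_top htop
    have hhk : Integrable (fun x => h x + k x) μ := hh.add hk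
    have e1 := integral_eq_lintegral_pos_part_sub_lintegral_neg_part hhk
    rw [integral_add hh hk, integral_eq_lintegral_of_nonneg_ae h0 hh.1] at e1
    have n1 := hhk.lintegral_lt_top.ne
    have n2 := hhk.neg.lintegral_lt_top.ne
    simp only [Pi.neg_apply] at n2
    lift ∫⁻ x, ENNReal.ofReal (h x) ∂μ to NNReal using htop with c0
    lift ∫⁻ x, ENNReal.ofReal (h x + k x) ∂μ to NNReal using n1 with c1
    lift ∫⁻ x, ENNReal.ofReal (-(h x + k x)) ∂μ to NNReal using n2 with c2
    simp only [ENNReal.coe_toReal] at e1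
    simp only [EReal.coe_nnreal_eq_coe_real]
    norm_cast
    exact e1.symm

/-! ### The free volume -/

theorem integrable_coe (f : Lp ℝ 1 surf) : Integrable f surf := L1.integrable_coeFn f

theorem norm_kernel_le (p q : S2) : ‖kernel p q‖ ≤ 1 := by
  rw [Real.norm_eq_abs, abs_le]
  exact ⟨by linarith [kernel_ge p q], kernel_le p q⟩

theorem integrable_kernel_mul (f : Lp ℝ 1 surf) (p : S2) :
    Integrable (fun q => kernel p q * f q) surf :=
  (integrable_coe f).bdd_mul (continuous_kernel_right p).aestronglyMeasurable
    (.of_forall (norm_kernel_le p))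

theorem integrable_prod_kernel_mul (f : Lp ℝ 1 surf) :
    Integrable (fun z : S2 × S2 => kernel z.1 z.2 * f z.2) (surf.prod surf) :=
  ((integrable_coe f).comp_snd surf).bdd_mul continuous_kernel.aestronglyMeasurable
    (.of_forall fun z => norm_kernel_le z.1 z.2)

theorem freeVolume_eq (η : ℝ) (f : Lp ℝ 1 surf) (p : S2) :
    freeVolume η f p = ∫ q, kernel p q * f q ∂surf - η := rfl

theorem le_freeVolume (η : ℝ) {f : Lp ℝ 1 surf} (hf : f ∈ densities) (p : S2) :
    -1 / 3 - η ≤ freeVolume η f p := by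
  rw [freeVolume_eq, sub_le_sub_iff_right]
  have h : ∫ q, (-1 / 3) * f q ∂surf ≤ ∫ q, kernel p q * f q ∂surf := by
    refine integral_mono_ae ((integrable_coe f).const_mul _) (integrable_kernel_mul f p) ?_
    filter_upwards [hf.1] with q hq
    exact mul_le_mul_of_nonneg_right (kernel_ge p q) hq
  rwa [integral_const_mul, hf.2, mul_one] at h

theorem freeVolume_le (η : ℝ) {f : Lp ℝ 1 surf} (hf : f ∈ densities) (p : S2) :
    freeVolume η f p ≤ 1 - η := by
  rw [freeVolume_eq, sub_le_sub_iff_right]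
  refine (integral_mono_ae (integrable_kernel_mul f p) (integrable_coe f) ?_).trans_eq hf.2
  filter_upwards [hf.1] with q hq
  exact mul_le_of_le_one_left hq (kernel_le p q)

theorem integrable_freeVolume (η : ℝ) (f : Lp ℝ 1 surf) : Integrable (freeVolume η f) surf :=
  (integrable_prod_kernel_mul f).integral_prod_left.sub (integrable_const η)

theorem measurable_freeVolume (η : ℝ) (f : Lp ℝ 1 surf) : Measurable (freeVolume η f) := by
  have h : StronglyMeasurable fun z : S2 × S2 => kernel z.1 z.2 * f z.2 :=
    continuous_kernel.stronglyMeasurable.mul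
      ((Lp.stronglyMeasurable f).comp_measurable measurable_snd)
  exact (h.integral_prod_right (ν := surf)).measurable.sub_const η

theorem integral_freeVolume (η : ℝ) (f : Lp ℝ 1 surf) :
    ∫ p, freeVolume η f p ∂surf = -(4 * Real.pi * η) := by
  simp_rw [freeVolume_eq]
  rw [integral_sub (integrable_prod_kernel_mul f).integral_prod_left (integrable_const η),
    integral_integral_swap (integrable_prod_kernel_mul f)]
  simp_rw [integral_mul_const, kernel_comm _ _, integral_kernel]
  simp [surf_real_univ]

theorem integral_kernel_mul_freeVolume (η : ℝ) (f : Lp ℝ 1 surf) (p : S2) :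
    ∫ q, kernel p q * freeVolume η f q ∂surf = 8 * Real.pi / 15 * (freeVolume η f p + η) := by
  have hi : Integrable (fun z : S2 × S2 => kernel p z.1 * (kernel z.1 z.2 * f z.2))
      (surf.prod surf) :=
    (integrable_prod_kernel_mul f).bdd_mul
      ((continuous_kernel_right p).comp continuous_fst).aestronglyMeasurable
      (.of_forall fun z => norm_kernel_le p z.1)
  simp_rw [freeVolume_eq, mul_sub]
  rw [integral_sub, integral_mul_const, integral_kernel, zero_mul, sub_zero, sub_add_cancel]
  · simp_rw [← integral_const_mul]
    rw [integral_integral_swap hi]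
    refine integral_congr_ae (.of_forall fun r => ?_)
    simp only [← mul_assoc]
    rw [integral_mul_const, integral_kernel_mul_kernel]
  · simpa only [integral_const_mul] using hi.integral_prod_left
  · exact (integrable_of_continuous (continuous_kernel_right p)).mul_const _

/-! ### The free energy as a relative entropy -/

/-- Up to a constant, the free energy is the relative entropy of `f` with respect to the free
volume normalised to a probability density: the total mass `-4πη` of the free volume does not
depend on `f`. -/
theorem freeEnergy_eq {η : ℝ} (hη : η < 0) {f : Lp ℝ 1 surf} (hf : f ∈ densities)
    (hV : ∀ᵐ p ∂surf, 0 < freeVolume η f p) :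
    freeEnergy η f =
      ((∫⁻ p, ENNReal.ofReal (gibbsDefect (f p) (freeVolume η f p / -(4 * Real.pi * η))) ∂surf :
        ENNReal) : EReal) + ((-Real.log (-(4 * Real.pi * η)) : ℝ) : EReal) := by
  have hc : 0 < -(4 * Real.pi * η) := by nlinarith [Real.pi_pos]
  have hcV := integral_freeVolume η f
  set c := -(4 * Real.pi * η)
  have hfi := integrable_coe f
  have hw : Integrable (fun p => freeVolume η f p / c) surf :=
    (integrable_freeVolume η f).div_const c
  have hfw : Integrable (fun p => f p - freeVolume η f p / c) surf := hfi.sub hw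
  have hk : ∫ p, (f p - freeVolume η f p / c - f p * Real.log c) ∂surf = -Real.log c := by
    rw [integral_sub hfw (hfi.mul_const _), integral_sub hfi hw, integral_div, hcV,
      integral_mul_const, hf.2, div_self hc.ne']
    ring
  rw [← hk]
  -- The integrand is the Gibbs defect of `f` and `V / c`, plus terms of integral `-ln c`.
  refine erealIntegral_eq_lintegral_add ?_ ?_ (hfw.sub (hfi.mul_const _)) ?_
  · have hm := (Lp.stronglyMeasurable f).measurable
    have hm' := (measurable_freeVolume η f).div_const c
    unfold gibbsDefect
    fun_prop
  · filter_upwards [hf.1, hV] with p hp hVp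
    exact gibbsDefect_nonneg hp (div_pos hVp hc)
  · filter_upwards [hV] with p hVp
    rw [negLog, if_pos hVp, ← EReal.coe_mul, ← EReal.coe_add, gibbsDefect,
      Real.log_div hVp.ne' hc.ne']
    congr 1
    ring

theorem neg_log_le_freeEnergy {η : ℝ} (hη : η < 0) {f : Lp ℝ 1 surf} (hf : f ∈ densities)
    (hV : ∀ᵐ p ∂surf, 0 < freeVolume η f p) :
    ((-Real.log (-(4 * Real.pi * η)) : ℝ) : EReal) ≤ freeEnergy η f := by
  rw [freeEnergy_eq hη hf hV]
  exact le_add_of_nonneg_left (EReal.coe_ennreal_nonneg _)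

/-- Equality in the Gibbs inequality: a density of least energy is proportional to its own free
volume. -/
theorem ae_eq_freeVolume_of_freeEnergy_eq {η : ℝ} (hη : η < 0) {f : Lp ℝ 1 surf}
    (hf : f ∈ densities) (hV : ∀ᵐ p ∂surf, 0 < freeVolume η f p)
    (h : freeEnergy η f = ((-Real.log (-(4 * Real.pi * η)) : ℝ) : EReal)) :
    ∀ᵐ p ∂surf, f p = freeVolume η f p / -(4 * Real.pi * η) := by
  have hc : 0 < -(4 * Real.pi * η) := by nlinarith [Real.pi_pos]
  rw [freeEnergy_eq hη hf hV] at h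
  have h0 : ∫⁻ p, ENNReal.ofReal
      (gibbsDefect (f p) (freeVolume η f p / -(4 * Real.pi * η))) ∂surf = 0 := by
    generalize ∫⁻ p, ENNReal.ofReal
      (gibbsDefect (f p) (freeVolume η f p / -(4 * Real.pi * η))) ∂surf = I at h ⊢
    induction I with
    | top =>
      rw [EReal.coe_ennreal_top, EReal.top_add_coe] at h
      exact absurd h (EReal.top_ne_coe _)
    | coe c =>
      rw [EReal.coe_nnreal_eq_coe_real] at h
      norm_cast at h
      have : (c : ℝ) = 0 := by linarith
      exact_mod_cast this
  rw [lintegral_eq_zero_iff] at h0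
  · filter_upwards [h0, hf.1, hV] with p hp hfp hVp
    have hb := div_pos hVp hc
    exact eq_of_gibbsDefect_eq_zero hfp hb
      (le_antisymm (ENNReal.ofReal_eq_zero.1 hp) (gibbsDefect_nonneg hfp hb))
  · have hm := (Lp.stronglyMeasurable f).measurable
    have hm' := (measurable_freeVolume η f).div_const (-(4 * Real.pi * η))
    unfold gibbsDefect
    fun_prop

/-! ### The isotropic state -/

theorem isotropic_ae_eq : ∀ᵐ p ∂surf, isotropic p = 1 / (4 * Real.pi) :=
  Lp.coeFn_const 1 surf (1 / (4 * Real.pi))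

theorem isotropic_mem_densities : isotropic ∈ densities := by
  constructor
  · filter_upwards [isotropic_ae_eq] with p hp
    rw [hp]
    positivity
  · rw [integral_congr_ae isotropic_ae_eq]
    rw [integral_const, surf_real_univ, smul_eq_mul]
    field_simp

theorem isotropic_mem_boundedDensities : isotropic ∈ boundedDensities := by
  refine ⟨isotropic_mem_densities, 4 * Real.pi, by positivity, ?_⟩
  filter_upwards [isotropic_ae_eq] with p hp
  rw [hp]
  refine ⟨le_rfl, ?_⟩
  have h : 1 ≤ 4 * Real.pi := by linarith [Real.pi_gt_three]
  exact ((div_le_one (by positivity)).2 h).trans h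

theorem freeVolume_isotropic (η : ℝ) (p : S2) : freeVolume η isotropic p = -η := by
  have h : ∫ q, kernel p q * isotropic q ∂surf = ∫ q, kernel p q * (1 / (4 * Real.pi)) ∂surf := by
    refine integral_congr_ae ?_
    filter_upwards [isotropic_ae_eq] with q hq
    rw [hq]
  rw [freeVolume_eq, h, integral_mul_const, integral_kernel]
  ring

theorem freeEnergy_isotropic {η : ℝ} (hη : η < 0) :
    freeEnergy η isotropic = ((-Real.log (-(4 * Real.pi * η)) : ℝ) : EReal) := by
  rw [freeEnergy_eq hη isotropic_mem_densities
    (.of_forall fun p => by rw [freeVolume_isotropic]; linarith)]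
  have h : ∀ᵐ p ∂surf, ENNReal.ofReal
      (gibbsDefect (isotropic p) (freeVolume η isotropic p / -(4 * Real.pi * η))) = 0 := by
    filter_upwards [isotropic_ae_eq] with p hp
    have e : -η / -(4 * Real.pi * η) = 1 / (4 * Real.pi) := by
      field_simp [hη.ne]
    rw [hp, freeVolume_isotropic, e, gibbsDefect_self, ENNReal.ofReal_zero]
  rw [lintegral_congr_ae h]
  simp

/-- If `f` is proportional to its own free volume `u - η`, then `u` satisfies `u = -2/(15η) u` by
the composition law of the kernel, so it vanishes unless `η = -2/15`. -/
theorem eq_isotropic_of_ae_eq_freeVolume {η : ℝ} (hη : η < 0) (hη' : η ≠ -2 / 15)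
    {f : Lp ℝ 1 surf} (h : ∀ᵐ p ∂surf, f p = freeVolume η f p / -(4 * Real.pi * η)) :
    f = isotropic := by
  have hV : ∀ p, freeVolume η f p = -η := by
    intro p
    have e : ∫ q, kernel p q * f q ∂surf =
        (∫ q, kernel p q * freeVolume η f q ∂surf) / -(4 * Real.pi * η) := by
      rw [← integral_div]
      refine integral_congr_ae ?_
      filter_upwards [h] with q hq
      rw [mul_div_assoc, ← hq]
    rw [integral_kernel_mul_freeVolume] at e
    have e2 := freeVolume_eq η f p
    have hη0 := hη.ne
    rw [e] at e2
    have e3 : (freeVolume η f p + η) * (η + 2 / 15) = 0 := by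
      field_simp at e2
      linear_combination e2 / 60
    rcases mul_eq_zero.1 e3 with h1 | h1
    · linarith
    · exact absurd (by linarith) hη'
  refine Lp.ext ?_
  filter_upwards [h, isotropic_ae_eq] with p hp hi
  rw [hp, hi, hV]
  field_simp [hη.ne]

/-! ### Positivity of the free volume -/

/-- The negative part of the energy density of a probability density is integrable, so that its
positive part alone decides whether the energy is finite. -/
theorem lintegral_neg_energy_ne_top {η : ℝ} (hη : η < 0) {f : Lp ℝ 1 surf} (hf : f ∈ densities) :
    ∫⁻ p, (-(((f p * Real.log (f p) : ℝ) : EReal) +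
      (f p : EReal) * negLog (freeVolume η f p))).toENNReal ∂surf ≠ ⊤ := by
  have hi : Integrable (fun p => 1 + f p * (1 - η)) surf :=
    (integrable_const 1).add ((integrable_coe f).mul_const _)
  refine ((lintegral_mono_ae ?_).trans_lt hi.lintegral_lt_top).ne
  filter_upwards [hf.1] with p hp
  rw [← EReal.real_coe_toENNReal]
  apply EReal.toENNReal_le_toENNReal
  have h0 : 0 ≤ 1 + f p * (1 - η) := by nlinarith
  rcases hp.eq_or_lt with hp | hp
  · simp [← hp]
  by_cases hV : 0 < freeVolume η f p
  · rw [negLog, if_pos hV, ← EReal.coe_mul, ← EReal.coe_add, ← EReal.coe_neg, EReal.coe_le_coe_iff]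
    -- The Gibbs inequality against `1` reads `f ln f ≥ f - 1`.
    have h1 := gibbsDefect_nonneg hp.le one_pos
    have h2 : Real.log (freeVolume η f p) ≤ 1 - η :=
      ((Real.log_le_sub_one_of_pos hV).trans (by linarith)).trans (freeVolume_le η hf p)
    have h3 := mul_le_mul_of_nonneg_left h2 hp.le
    rw [gibbsDefect, Real.log_one] at h1
    linarith
  -- Where the free volume is not positive the energy density is `+∞`, with no negative part.
  · rw [negLog, if_neg hV, EReal.coe_mul_top_of_pos hp, EReal.coe_add_top]
    simp

/-- If `V ≤ 0` on a set of positive measure, the energy of a density bounded away from zero is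
`+∞` there, and the total energy is `+∞ - c` with `c` finite. -/
theorem freeVolume_pos_of_mem {η : ℝ} (hη : η < 0) {f : Lp ℝ 1 surf}
    (hf : f ∈ boundedDensities ∩ energyDomain η) : ∀ᵐ p ∂surf, 0 < freeVolume η f p := by
  obtain ⟨⟨hd, M, hM, hfM⟩, -, hlt⟩ := hf
  have hneg := lintegral_neg_energy_ne_top hη hd
  rw [freeEnergy, erealIntegral] at hlt
  by_contra hV
  have hS : MeasurableSet {p | ¬ 0 < freeVolume η f p} :=
    (measurableSet_lt measurable_const (measurable_freeVolume η f)).compl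
  have hpos : ∫⁻ p, (((f p * Real.log (f p) : ℝ) : EReal) +
      (f p : EReal) * negLog (freeVolume η f p)).toENNReal ∂surf = ⊤ := by
    rw [← top_le_iff]
    calc (⊤ : ENNReal) = ⊤ * surf {p | ¬ 0 < freeVolume η f p} :=
          (ENNReal.top_mul hV).symm
      _ = ∫⁻ p in {p | ¬ 0 < freeVolume η f p}, ⊤ ∂surf := (setLIntegral_const _ _).symm
      _ ≤ ∫⁻ p in {p | ¬ 0 < freeVolume η f p}, (((f p * Real.log (f p) : ℝ) : EReal) +
            (f p : EReal) * negLog (freeVolume η f p)).toENNReal ∂surf := by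
          refine lintegral_mono_ae ?_
          filter_upwards [ae_restrict_mem hS, ae_restrict_of_ae hfM] with p hp hfp
          have hfp' : 0 < f p := (one_div_pos.2 hM).trans_le hfp.1
          rw [negLog, if_neg hp, EReal.coe_mul_top_of_pos hfp', EReal.coe_add_top,
            EReal.toENNReal_top]
      _ ≤ _ := setLIntegral_le_lintegral _ _
  rw [hpos] at hlt
  lift ∫⁻ p, (-(((f p * Real.log (f p) : ℝ) : EReal) +
      (f p : EReal) * negLog (freeVolume η f p))).toENNReal ∂surf to NNReal using hneg with c
  rw [EReal.coe_ennreal_top, EReal.coe_nnreal_eq_coe_real, EReal.top_sub_coe] at hlt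
  exact lt_irrefl _ hlt

/-! ### Minimality of the isotropic state -/

theorem isGlobalMinimiserOn_isotropic {η : ℝ} (hη : η < 0) {S : Set (Lp ℝ 1 surf)}
    (hi : isotropic ∈ S) (hS : S ⊆ densities)
    (hV : ∀ f ∈ S, ∀ᵐ p ∂surf, 0 < freeVolume η f p) :
    IsGlobalMinimiserOn (freeEnergy η) S isotropic := by
  refine ⟨hi, fun f hf => ?_⟩
  rw [freeEnergy_isotropic hη]
  exact neg_log_le_freeEnergy hη (hS hf) (hV f hf)

theorem isUniqueGlobalMinimiserOn_isotropic {η : ℝ} (hη : η < 0) (hη' : η ≠ -2 / 15)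
    {S : Set (Lp ℝ 1 surf)} (hi : isotropic ∈ S) (hS : S ⊆ densities)
    (hV : ∀ f ∈ S, ∀ᵐ p ∂surf, 0 < freeVolume η f p) :
    IsUniqueGlobalMinimiserOn (freeEnergy η) S isotropic := by
  have hmin := isGlobalMinimiserOn_isotropic hη hi hS hV
  refine ⟨hmin, fun f hf => ?_⟩
  have h := le_antisymm (hf.2 _ hi) (hmin.2 _ hf.1)
  rw [freeEnergy_isotropic hη] at h
  exact eq_isotropic_of_ae_eq_freeVolume hη hη'
    (ae_eq_freeVolume_of_freeEnergy_eq hη (hS hf.1) (hV f hf.1) h)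

end DenseNematic

theorem mainTheorem11 (η : ℝ) :
    (η < 0 →
      DenseNematic.IsGlobalMinimiserOn (DenseNematic.freeEnergy η)
          (DenseNematic.boundedDensities ∩ DenseNematic.energyDomain η)
          DenseNematic.isotropic ∧
        (η ≠ -2 / 15 →
          DenseNematic.IsUniqueGlobalMinimiserOn (DenseNematic.freeEnergy η)
            (DenseNematic.boundedDensities ∩ DenseNematic.energyDomain η)
            DenseNematic.isotropic)) ∧
      (η < -1 / 3 →
        DenseNematic.IsUniqueGlobalMinimiserOn (DenseNematic.freeEnergy η)
          DenseNematic.densities DenseNematic.isotropic) := by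
  open DenseNematic in
  constructor
  · intro hη
    have hi : isotropic ∈ boundedDensities ∩ energyDomain η :=
      ⟨isotropic_mem_boundedDensities, isotropic_mem_densities, by
        rw [freeEnergy_isotropic hη]; exact EReal.coe_lt_top _⟩
    have hS : boundedDensities ∩ energyDomain η ⊆ densities := fun f hf => hf.1.1
    exact ⟨isGlobalMinimiserOn_isotropic hη hi hS fun f => freeVolume_pos_of_mem hη,
      fun hη' => isUniqueGlobalMinimiserOn_isotropic hη hη' hi hS
        fun f => freeVolume_pos_of_mem hη⟩
  · intro hη
    exact isUniqueGlobalMinimiserOn_isotropic (by linarith) (by intro h; linarith)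
      isotropic_mem_densities subset_rfl
      fun f hf => .of_forall fun p => by linarith [le_freeVolume η hf p]
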